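/- Let $d$ be a natural number and, for each $x\in\mathbb Z^d$, let $M_x>0$ be a real number and $\nu_x$ a probability function on $\mathbb N_0=\{0,1,2,\dots\}$. Assume $$0<\inf_{x\in\mathbb Z^d}M_x\le\sup_{x\in\mathbb Z^d}M_x<\infty\qquad\text{and}\qquad\sum_{r\ge 1}r^d\sup_{x\in\mathbb Z^d}\nu_x(r)<\infty .$$ Let $\{(\mathcal T_x,\mathcal K_x):x\in\mathbb Z^d\}$ be a family of mutually independent marked Poisson processes on $[0,\infty)$: for each $x$, $\mathcal T_x=(T_{x,n})_n$ are the successive epochs of a homogeneous Poisson process of rate $M_x$ (that is, the waiting times $T_{x,1},\,T_{x,2}-T_{x,1},\dots$ are i.i.d. exponential with rate $M_x$), $\mathcal K_x=(K_{x,n})_n$ is a sequence of i.i.d. random variables with law $\nu_x$, and $\mathcal T_x$ and $\mathcal K_x$ are independent. For $t\ge 0$ let the Harris random graph $\mathcal G_{0,t}$ be the undirected graph with vertex set $\mathbb Z^d$ in which two distinct sites $x,y$ are joined by an edge if and only if there is an $n$ with $T_{x,n}\in(0,t]$ and $\|y-x\|_1\le K_{x,n}$, or there is an $m$ with $T_{y,m}\in(0,t]$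 and $\|x-y\|_1\le K_{y,m}$. Then there exists a deterministic $t_0>0$, depending only on $d$, $(M_x)_x$ and $(\nu_x)_x$, such that for every $t$ with $0\le t\le t_0$, almost surely all connected components of $\mathcal G_{0,t}$ are finite. -/

import Mathlib

open MeasureTheory ProbabilityTheory
open scoped ENNReal

/-- The closed ball of radius `r` around `x` in `ℤ^d`, for the `L¹` norm. -/
def l1Ball {d : ℕ} (x : Fin d → ℤ) (r : ℕ) : Set (Fin d → ℤ) :=
  {y | ∑ i, |y i - x i| ≤ (r : ℤ)}

/-- The waiting times `T 0, T 1 - T 0, T 2 - T 1, …` between successive epochs of a clock that is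
started at time `0`. -/
def interarrival {Ω : Type*} (T : ℕ → Ω → ℝ) : ℕ → Ω → ℝ
  | 0, ω => T 0 ω
  | n + 1, ω => T (n + 1) ω - T n ω

/-- `T 0, T 1, …` are the successive epochs of a homogeneous Poisson process of the given rate on
the time line `[0, ∞)`: the waiting times are independent and exponential with that rate. -/
structure IsPoissonProcess {Ω : Type*} [MeasurableSpace Ω] (P : Measure Ω)
    (rate : ℝ) (T : ℕ → Ω → ℝ) : Prop where
  measurable : ∀ n, Measurable (T n)
  indep : iIndepFun (interarrival T) P
  law : ∀ n, P.map (interarrival T n) = expMeasure rate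

/-- A Poisson process with epochs `T n` of the given rate, whose epochs carry i.i.d. marks `K n`
with probability function `ν`; the sequence of marks is independent of the sequence of epochs. -/
structure IsMarkedPoissonProcess {Ω : Type*} [MeasurableSpace Ω] (P : Measure Ω)
    (rate : ℝ) (ν : PMF ℕ) (T : ℕ → Ω → ℝ) (K : ℕ → Ω → ℕ) : Prop where
  poisson : IsPoissonProcess P rate T
  measurable_mark : ∀ n, Measurable (K n)
  indep_mark : iIndepFun K P
  law_mark : ∀ n, P.map (K n) = ν.toMeasure
  indep : IndepFun (fun ω n => T n ω) (fun ω n => K n ω) P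

/-- A family, indexed by the sites of `ℤ^d`, of mutually independent marked Poisson processes with
rates `M x` and mark distributions `ν x`. -/
structure IsMarkedPoissonFamily {Ω : Type*} [MeasurableSpace Ω] (P : Measure Ω) {d : ℕ}
    (M : (Fin d → ℤ) → ℝ) (ν : (Fin d → ℤ) → PMF ℕ)
    (T : (Fin d → ℤ) → ℕ → Ω → ℝ) (K : (Fin d → ℤ) → ℕ → Ω → ℕ) : Prop where
  marked : ∀ x, IsMarkedPoissonProcess P (M x) (ν x) (T x) (K x)
  indep : iIndepFun (fun x ω => ((fun n => T x n ω : ℕ → ℝ), (fun n => K x n ω : ℕ → ℕ))) P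

/-- The Harris graph on `ℤ^d` for the time interval `(τ, t]`, for given epochs `T x n` and marks
`K x n`: distinct sites `x`, `y` are joined when some epoch of `x` in `(τ, t]` has a mark whose
ball around `x` contains `y`, or the same with `x` and `y` exchanged. -/
def harrisGraph {d : ℕ} (T : (Fin d → ℤ) → ℕ → ℝ) (K : (Fin d → ℤ) → ℕ → ℕ) (τ t : ℝ) :
    SimpleGraph (Fin d → ℤ) where
  Adj x y := x ≠ y ∧
    ((∃ n, T x n ∈ Set.Ioc τ t ∧ y ∈ l1Ball x (K x n)) ∨
      (∃ m, T y m ∈ Set.Ioc τ t ∧ x ∈ l1Ball y (K y m)))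
  symm := ⟨fun _ _ h => ⟨h.1.symm, h.2.symm⟩⟩
  loopless := ⟨fun _ h => h.1 rfl⟩

open Filter Topology

/-! This is a multiscale argument for a dominating Boolean model. Let the radius of a site be its
`reach`, the largest mark seen up to time `t`. The radii are independent, every edge is a link of
the model, and `IsMarkedPoissonProcess.measure_le_reach_le` bounds their tails by a small factor of
order `t` times the tail of `s r = ⨆ x, ν x r`.

A crossing at scale `8r` forces either a radius at least `r` nearby or two crossings at scale `r` in
disjoint boxes, hence independent (`exists_of_crosses_eight_mul`, `indep_crosses`). So the largest
crossing probability `p r` satisfies `p (8r) ≤ 49^(2d) * p r ^ 2 + g r`. The error `g r` is small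
for small `t` and tends to `0` because `∑ r^d s r` converges; thus `p (8^n)` tends to `0`
(`tendsto_crossProb`).

By `exists_of_infinite_component`, an infinite component through `x` requires, at every scale, a
crossing or an atypically long radius. These events have vanishing probability along the scales
`8^n`, and a union over the countably many `x` concludes (`ae_finite_components`). -/

/-! ### Sup-norm geometry of `ℤ^d`: boxes and grids. -/

/-- The distance of the supremum norm on `ℤ^d`, as a natural number. -/
def supDist {d : ℕ} (x y : Fin d → ℤ) : ℕ :=
  Finset.univ.sup fun i => (y i - x i).natAbs

theorem supDist_le_iff {d : ℕ} {x y : Fin d → ℤ} {r : ℕ} :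
    supDist x y ≤ r ↔ ∀ i, (y i - x i).natAbs ≤ r := by
  simp [supDist]

theorem natAbs_sub_le_supDist {d : ℕ} (x y : Fin d → ℤ) (i : Fin d) :
    (y i - x i).natAbs ≤ supDist x y :=
  supDist_le_iff.1 le_rfl i

theorem supDist_self {d : ℕ} (x : Fin d → ℤ) : supDist x x = 0 :=
  Nat.le_zero.1 (supDist_le_iff.2 fun i => by simp)

theorem supDist_comm {d : ℕ} (x y : Fin d → ℤ) : supDist x y = supDist y x := by
  have key : ∀ x y : Fin d → ℤ, supDist x y ≤ supDist y x := fun x y =>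
    supDist_le_iff.2 fun i => by
      have := natAbs_sub_le_supDist y x i
      omega
  exact le_antisymm (key x y) (key y x)

theorem supDist_triangle {d : ℕ} (x y z : Fin d → ℤ) :
    supDist x z ≤ supDist x y + supDist y z :=
  supDist_le_iff.2 fun i => by
    have h₁ := natAbs_sub_le_supDist x y i
    have h₂ := natAbs_sub_le_supDist y z i
    omega

theorem supDist_pos {d : ℕ} {x y : Fin d → ℤ} (h : x ≠ y) : 0 < supDist x y := by
  by_contra h₀
  refine h (funext fun i => ?_)
  have := natAbs_sub_le_supDist x y i
  omega

theorem supDist_le_of_mem_l1Ball {d : ℕ} {x y : Fin d → ℤ} {r : ℕ} (h : y ∈ l1Ball x r) :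
    supDist x y ≤ r :=
  supDist_le_iff.2 fun i => by
    have h₁ : |y i - x i| ≤ ∑ j, |y j - x j| :=
      Finset.single_le_sum (f := fun j => |y j - x j|) (fun j _ => abs_nonneg _)
        (Finset.mem_univ i)
    zify
    exact h₁.trans h

/-- The box of centre `x` and radius `r` in `ℤ^d`. -/
noncomputable def box {d : ℕ} (x : Fin d → ℤ) (r : ℕ) : Finset (Fin d → ℤ) :=
  Fintype.piFinset fun i => Finset.Icc (x i - r) (x i + r)

theorem mem_box {d : ℕ} {x y : Fin d → ℤ} {r : ℕ} : y ∈ box x r ↔ supDist x y ≤ r := by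
  simp only [box, Fintype.mem_piFinset, Finset.mem_Icc, supDist_le_iff]
  refine forall_congr' fun i => ?_
  omega

theorem card_box {d : ℕ} (x : Fin d → ℤ) (r : ℕ) : (box x r).card = (2 * r + 1) ^ d := by
  have h : ∀ i, (x i + r + 1 - (x i - r)).toNat = 2 * r + 1 := fun i => by omega
  simp [box, Fintype.card_piFinset, Int.card_Icc, h]

/-- The point of the grid `x + r ℤ^d` with coordinates `j`. -/
def gridPoint {d : ℕ} (x : Fin d → ℤ) (r : ℕ) (j : Fin d → ℤ) : Fin d → ℤ :=
  fun i => x i + r * j i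

theorem exists_gridPoint_near {d : ℕ} (x u : Fin d → ℤ) {r n : ℕ} (hr : 0 < r)
    (hu : supDist x u ≤ n * r) :
    ∃ j ∈ box (0 : Fin d → ℤ) n, supDist (gridPoint x r j) u ≤ r := by
  refine ⟨fun i => (u i - x i) / r, mem_box.2 (supDist_le_iff.2 fun i => ?_),
    supDist_le_iff.2 fun i => ?_⟩
  · have h₁ := supDist_le_iff.1 hu i
    have hr' : (0 : ℤ) < r := by exact_mod_cast hr
    have h₂ : -((n : ℤ) * r) ≤ u i - x i ∧ u i - x i ≤ (n : ℤ) * r := by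
      zify at h₁
      exact abs_le.1 h₁
    have h₃ : -(n : ℤ) ≤ (u i - x i) / r := by
      rw [Int.le_ediv_iff_mul_le hr']
      linarith [h₂.1]
    have h₄ : (u i - x i) / r ≤ n := Int.ediv_le_of_le_mul hr' h₂.2
    simp only [Pi.zero_apply, sub_zero]
    omega
  · have hr' : (0 : ℤ) < r := by exact_mod_cast hr
    have h₁ := Int.emod_add_mul_ediv (u i - x i) r
    have h₂ := Int.emod_nonneg (u i - x i) hr'.ne'
    have h₃ := Int.emod_lt_of_pos (u i - x i) hr'
    simp only [gridPoint]
    omega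

/-! ### Deterministic part: links, paths and crossings. -/

/-- One of the two sites lies within the reach of the other one, for the radii `R`. -/
def Linked {d : ℕ} (R : (Fin d → ℤ) → ℕ∞) (u v : Fin d → ℤ) : Prop :=
  (supDist u v : ℕ∞) ≤ R u ∨ (supDist u v : ℕ∞) ≤ R v

theorem Linked.symm {d : ℕ} {R : (Fin d → ℤ) → ℕ∞} {u v : Fin d → ℤ} (h : Linked R u v) :
    Linked R v u := by
  rw [Linked, supDist_comm]
  exact Or.symm h

/-- A link between two sites of `A`. -/
def LinkedIn {d : ℕ} (R : (Fin d → ℤ) → ℕ∞) (A : Set (Fin d → ℤ)) (u v : Fin d → ℤ) : Prop :=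
  u ∈ A ∧ v ∈ A ∧ Linked R u v

theorem LinkedIn.mono {d : ℕ} {R : (Fin d → ℤ) → ℕ∞} {A B : Set (Fin d → ℤ)} (hAB : A ⊆ B)
    {u v : Fin d → ℤ} (h : LinkedIn R A u v) : LinkedIn R B u v :=
  ⟨hAB h.1, hAB h.2.1, h.2.2⟩

theorem linkedIn_congr {d : ℕ} {R R' : (Fin d → ℤ) → ℕ∞} {A : Set (Fin d → ℤ)}
    (h : ∀ x ∈ A, R x = R' x) : LinkedIn R A = LinkedIn R' A := by
  funext u v
  refine propext (and_congr_right fun hu => and_congr_right fun hv => ?_)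
  rw [Linked, Linked, h u hu, h v hv]

theorem reflTransGen_linkedIn_symm {d : ℕ} {R : (Fin d → ℤ) → ℕ∞} {A : Set (Fin d → ℤ)}
    {u v : Fin d → ℤ} (h : Relation.ReflTransGen (LinkedIn R A) u v) :
    Relation.ReflTransGen (LinkedIn R A) v u :=
  have : Std.Symm (LinkedIn R A) := ⟨fun _ _ h => ⟨h.2.1, h.1, h.2.2.symm⟩⟩
  Std.Symm.symm _ _ h

/-- A path from `A` to its complement stays in `A` until the step at which it leaves `A`. -/
theorem exists_first_exit {d : ℕ} {R : (Fin d → ℤ) → ℕ∞} {A B : Set (Fin d → ℤ)}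
    {u v : Fin d → ℤ} (h : Relation.ReflTransGen (LinkedIn R B) u v) (hu : u ∈ A) (hv : v ∉ A) :
    ∃ w w', Relation.ReflTransGen (LinkedIn R A) u w ∧ w ∈ A ∧ w' ∉ A ∧ LinkedIn R B w w' := by
  have key : ∀ v, Relation.ReflTransGen (LinkedIn R B) u v →
      (v ∈ A ∧ Relation.ReflTransGen (LinkedIn R A) u v) ∨
      ∃ w w', Relation.ReflTransGen (LinkedIn R A) u w ∧ w ∈ A ∧ w' ∉ A ∧ LinkedIn R B w w' := by
    intro v h
    induction h with
    | refl => exact Or.inl ⟨hu, .refl⟩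
    | @tail b c _ hbc ih =>
      rcases ih with ⟨hb, hub⟩ | ih
      · by_cases hc : c ∈ A
        · exact Or.inl ⟨hc, hub.tail ⟨hb, hc, hbc.2.2⟩⟩
        · exact Or.inr ⟨b, c, hub, hb, hc, hbc⟩
      · exact Or.inr ih
  exact (key v h).resolve_left fun h' => hv h'.1

/-- The radii `R` link the box of radius `r` around `x` with the outside of the box of radius `2r`
by a path in the box of radius `3r`. -/
def Crosses {d : ℕ} (R : (Fin d → ℤ) → ℕ∞) (x : Fin d → ℤ) (r : ℕ) : Prop :=
  ∃ u v, supDist x u ≤ r ∧ 2 * r < supDist x v ∧ supDist x v ≤ 3 * r ∧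
    Relation.ReflTransGen (LinkedIn R (box x (3 * r))) u v

/-- Locality of crossings, the source of independence over disjoint boxes. -/
theorem crosses_congr {d : ℕ} {R R' : (Fin d → ℤ) → ℕ∞} {x : Fin d → ℤ} {r : ℕ}
    (h : ∀ y ∈ box x (3 * r), R y = R' y) : Crosses R x r ↔ Crosses R' x r := by
  rw [Crosses, Crosses, linkedIn_congr (R := R) (R' := R') h]

/-- A path that leaves the box of radius `2r` around `x` by a short step crosses. -/
theorem crosses_of_exit {d : ℕ} {R : (Fin d → ℤ) → ℕ∞} {x u w w' : Fin d → ℤ} {r : ℕ}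
    (hu : supDist x u ≤ r)
    (huw : Relation.ReflTransGen (LinkedIn R (box x (2 * r))) u w)
    (hw : supDist x w ≤ 2 * r) (hw' : 2 * r < supDist x w') (hw'' : supDist x w' ≤ 3 * r)
    (h : Linked R w w') : Crosses R x r := by
  refine ⟨u, w', hu, hw', hw'', (Relation.ReflTransGen.mono (fun a b hab => LinkedIn.mono ?_ hab) _ _ huw).tail
    ⟨mem_box.2 (by omega), mem_box.2 hw'', h⟩⟩
  intro y hy
  have hy' := mem_box.1 hy
  exact mem_box.2 (by omega)

/-- Since links in `B` are shorter than `r`, the step that leaves the box of radius `2r` cannot jump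
beyond radius `3r`. -/
theorem crosses_of_path_of_short {d : ℕ} {R : (Fin d → ℤ) → ℕ∞} {B : Set (Fin d → ℤ)} {r : ℕ}
    (hB : ∀ y ∈ B, R y < r) {k u v : Fin d → ℤ}
    (h : Relation.ReflTransGen (LinkedIn R B) u v) (hu : supDist k u ≤ r)
    (hv : 2 * r < supDist k v) : Crosses R k r := by
  obtain ⟨w, w', huw, hw, hw', hww'⟩ := exists_first_exit (A := box k (2 * r)) h
    (mem_box.2 (by omega)) (fun h => by have := mem_box.1 h; omega)
  have hw := mem_box.1 hw
  have hw' : 2 * r < supDist k w' := not_le.1 fun h => hw' (mem_box.2 h)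
  have hlt : supDist w w' < r := by
    rcases hww'.2.2 with h | h
    · exact_mod_cast h.trans_lt (hB _ hww'.1)
    · exact_mod_cast h.trans_lt (hB _ hww'.2.1)
  have := supDist_triangle k w w'
  exact crosses_of_exit hu huw hw hw' (by omega) hww'.2.2

/-- A crossing at scale `8r` comes from a long link, or from two distant crossings at scale `r`. -/
theorem exists_of_crosses_eight_mul {d : ℕ} {R : (Fin d → ℤ) → ℕ∞} {x : Fin d → ℤ} {r : ℕ}
    (hr : 0 < r) (h : Crosses R x (8 * r)) :
    (∃ y ∈ box x (24 * r), (r : ℕ∞) ≤ R y) ∨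
    ∃ j ∈ box (0 : Fin d → ℤ) 24, ∃ j' ∈ box (0 : Fin d → ℤ) 24,
      Disjoint (box (gridPoint x r j) (3 * r)) (box (gridPoint x r j') (3 * r)) ∧
      Crosses R (gridPoint x r j) r ∧ Crosses R (gridPoint x r j') r := by
  by_cases hlong : ∃ y ∈ box x (24 * r), (r : ℕ∞) ≤ R y
  · exact Or.inl hlong
  push Not at hlong
  obtain ⟨u, v, hu, hv, hv', huv⟩ := h
  have e : 3 * (8 * r) = 24 * r := by ring
  rw [e] at hv' huv
  obtain ⟨j, hj, hju⟩ := exists_gridPoint_near x u (n := 24) hr (by omega)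
  obtain ⟨j', hj', hjv⟩ := exists_gridPoint_near x v (n := 24) hr (by omega)
  refine Or.inr ⟨j, hj, j', hj', ?_, ?_, ?_⟩
  -- This fixes the ratio `8`: a common point would be within `r + 3r` of both `u` and `v`, so `v`
  -- would be within `8r + 4r + 4r = 16r` of `x`.
  · rw [Finset.disjoint_left]
    intro w hw hw'
    have h₁ := mem_box.1 hw
    have h₂ := mem_box.1 hw'
    have h₃ := supDist_triangle x u w
    have h₄ := supDist_triangle u (gridPoint x r j) w
    have h₅ := supDist_triangle x w v
    have h₆ := supDist_triangle w (gridPoint x r j') v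
    rw [supDist_comm u (gridPoint x r j)] at h₄
    rw [supDist_comm w (gridPoint x r j')] at h₆
    omega
  · refine crosses_of_path_of_short hlong huv hju ?_
    have h₁ := supDist_triangle x u v
    have h₂ := supDist_triangle u (gridPoint x r j) v
    rw [supDist_comm u (gridPoint x r j)] at h₂
    omega
  · refine crosses_of_path_of_short hlong (reflTransGen_linkedIn_symm huv) hjv ?_
    have h₁ := supDist_triangle x u v
    have h₂ := supDist_triangle u (gridPoint x r j') v
    rw [supDist_comm u (gridPoint x r j')] at h₂
    omega

/-- Base scale: the endpoints of a crossing differ, so some step of the path has positive length. -/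
theorem exists_of_crosses_one {d : ℕ} {R : (Fin d → ℤ) → ℕ∞} {x : Fin d → ℤ}
    (h : Crosses R x 1) : ∃ y ∈ box x 3, ((1 : ℕ) : ℕ∞) ≤ R y := by
  obtain ⟨u, v, hu, hv, -, huv⟩ := h
  obtain ⟨w, w', -, hw, hw', hww'⟩ := exists_first_exit (A := {u}) huv rfl (by
    rintro rfl
    omega)
  have hne : w ≠ w' := by
    rintro rfl
    exact hw' hw
  have hpos : ((1 : ℕ) : ℕ∞) ≤ (supDist w w' : ℕ∞) := Nat.cast_le.2 (supDist_pos hne)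
  rcases hww'.2.2 with h | h
  · exact ⟨w, hww'.1, hpos.trans h⟩
  · exact ⟨w', hww'.2.1, hpos.trans h⟩

/-- An infinite component causes, at every scale, a crossing, a long link from a near site, or a
link from a distant site whose length is comparable to the distance of that site. -/
theorem exists_of_infinite_component {d : ℕ} {R : (Fin d → ℤ) → ℕ∞}
    {G : SimpleGraph (Fin d → ℤ)} (hG : ∀ u v, G.Adj u v → Linked R u v)
    {C : G.ConnectedComponent} (hC : C.supp.Infinite) {x : Fin d → ℤ} (hx : x ∈ C.supp) (r : ℕ) :
    Crosses R x r ∨ (∃ u ∈ box x (2 * r), (r : ℕ∞) ≤ R u) ∨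
      ∃ w, 3 * r < supDist x w ∧ (supDist x w : ℕ∞) ≤ 3 * R w := by
  obtain ⟨v, hv, hvx⟩ := hC.exists_notMem_finset (box x (2 * r))
  have hreach : G.Reachable x v := C.reachable_of_mem_supp hx hv
  have hpath : Relation.ReflTransGen (LinkedIn R Set.univ) x v :=
    Relation.ReflTransGen.mono (fun a b h => ⟨trivial, trivial, hG a b h⟩) _ _
      ((SimpleGraph.reachable_iff_reflTransGen x v).1 hreach)
  have hxx := supDist_self x
  obtain ⟨w, w', hxw, hw, hw', -, -, hlink⟩ := exists_first_exit (A := box x (2 * r)) hpath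
    (mem_box.2 (by omega)) hvx
  have hw₁ := mem_box.1 hw
  have hw'₁ : 2 * r < supDist x w' := not_le.1 fun h => hw' (mem_box.2 h)
  by_cases hfar : supDist x w' ≤ 3 * r
  · exact Or.inl (crosses_of_exit (by omega) hxw hw₁ hw'₁ hfar hlink)
  -- The step jumps from radius at most `2r` to beyond `3r`, so its length exceeds both `r` and a
  -- third of the distance from `x` to `w'`.
  have htri := supDist_triangle x w w'
  rcases hlink with h | h
  · exact Or.inr (Or.inl ⟨w, hw, le_trans (Nat.cast_le.2 (by omega)) h⟩)
  · refine Or.inr (Or.inr ⟨w', by omega, le_trans ?_ (mul_le_mul_right h 3)⟩)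
    exact_mod_cast (by omega : supDist x w' ≤ 3 * supDist w w')

/-! ### Tails of series and a quadratic recursion. -/

/-- The tail `∑_{j ≥ r} f j` of a series. -/
noncomputable def tailSum (f : ℕ → ℝ≥0∞) (r : ℕ) : ℝ≥0∞ :=
  ∑' j, if r ≤ j then f j else 0

theorem tailSum_le_tsum (f : ℕ → ℝ≥0∞) (r : ℕ) : tailSum f r ≤ ∑' j, f j :=
  ENNReal.tsum_le_tsum fun j => by split_ifs <;> simp

theorem tendsto_tailSum {f : ℕ → ℝ≥0∞} (hf : ∑' j, f j ≠ ∞) :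
    Tendsto (tailSum f) atTop (𝓝 0) := by
  have h : tailSum f = fun r => ∑' j, f (j + r) := by
    funext r
    have h₁ := Summable.sum_add_tsum_nat_add' (f := fun j => if r ≤ j then f j else 0) (k := r)
      ENNReal.summable
    have h₂ : ∑ j ∈ Finset.range r, (if r ≤ j then f j else 0) = 0 :=
      Finset.sum_eq_zero fun j hj => if_neg (not_le.2 (Finset.mem_range.1 hj))
    rw [h₂, zero_add] at h₁
    rw [tailSum, ← h₁]
    exact tsum_congr fun j => if_pos (Nat.le_add_left r j)
  rw [h]
  exact ENNReal.tendsto_sum_nat_add f hf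

theorem pow_mul_tailSum_le (s : ℕ → ℝ≥0∞) (d r : ℕ) :
    (r : ℝ≥0∞) ^ d * tailSum s r ≤ tailSum (fun j => (j : ℝ≥0∞) ^ d * s j) r := by
  rw [tailSum, tailSum, ← ENNReal.tsum_mul_left]
  refine ENNReal.tsum_le_tsum fun j => ?_
  split_ifs with h
  · gcongr
  · simp

theorem card_box_le {d : ℕ} (x : Fin d → ℤ) {n r : ℕ} (hr : 0 < r) :
    ((box x (n * r)).card : ℝ≥0∞) ≤ ((2 * n + 1 : ℕ) : ℝ≥0∞) ^ d * (r : ℝ≥0∞) ^ d := by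
  rw [card_box, ← mul_pow, ← Nat.cast_mul, ← Nat.cast_pow, Nat.cast_le]
  refine Nat.pow_le_pow_left ?_ d
  nlinarith

/-- A quadratic recursion with a small start and a small vanishing perturbation tends to `0`. -/
theorem tendsto_zero_of_le_sq {a g : ℕ → ℝ≥0∞} {A b : ℝ≥0∞} (hA : A * (2 * b) ≤ 2⁻¹)
    (hb : b ≠ ∞) (h₀ : a 0 ≤ 2 * b) (hg : ∀ n, g n ≤ b) (hg' : Tendsto g atTop (𝓝 0))
    (h : ∀ n, a (n + 1) ≤ A * a n ^ 2 + g n) : Tendsto a atTop (𝓝 0) := by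
  -- While `a n ≤ 2 * b`, the quadratic term is at most half of `a n`. This keeps the bound `2 * b`
  -- invariant, and then the limsup, being finite and at most half of itself, vanishes.
  have hstep : ∀ n, a n ≤ 2 * b → a (n + 1) ≤ 2⁻¹ * a n + g n := fun n hn =>
    (h n).trans (add_le_add_left (by
      calc A * a n ^ 2 = A * a n * a n := by ring
        _ ≤ A * (2 * b) * a n := by gcongr
        _ ≤ 2⁻¹ * a n := by gcongr) _)
  have hbd : ∀ n, a n ≤ 2 * b := by
    intro n
    induction n with
    | zero => exact h₀
    | succ n ih =>
      calc a (n + 1) ≤ 2⁻¹ * a n + g n := hstep n ih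
        _ ≤ 2⁻¹ * (2 * b) + b := by gcongr; exact hg n
        _ = 2 * b := by
          rw [← mul_assoc, ENNReal.inv_mul_cancel two_ne_zero ENNReal.ofNat_ne_top, one_mul,
            two_mul]
  have hlim : limsup a atTop ≤ 2 * b := limsup_le_of_le (h := Eventually.of_forall hbd)
  have hfin : limsup a atTop ≠ ∞ := ne_top_of_le_ne_top (ENNReal.mul_ne_top (by simp) hb) hlim
  have hle : limsup a atTop ≤ 2⁻¹ * limsup a atTop := by
    calc limsup a atTop = limsup (fun n => a (n + 1)) atTop := (limsup_nat_add a 1).symm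
      _ ≤ limsup (fun n => 2⁻¹ * a n + g n) atTop :=
        limsup_le_limsup (Eventually.of_forall fun n => hstep n (hbd n))
      _ = limsup (fun n => 2⁻¹ * a n) atTop :=
        ENNReal.limsup_add_of_right_tendsto_zero hg' fun n => 2⁻¹ * a n
      _ = 2⁻¹ * limsup a atTop := ENNReal.limsup_const_mul_of_ne_top (by simp)
  have hzero : limsup a atTop = 0 := by
    by_contra hne
    have := ENNReal.half_lt_self hne hfin
    rw [ENNReal.div_eq_inv_mul] at this
    exact absurd hle (not_le.2 this)
  exact tendsto_of_le_liminf_of_limsup_le zero_le hzero.le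

/-! ### Probabilities of crossings and of long radii. -/

theorem indep_crosses {Ω : Type*} [MeasurableSpace Ω] {P : Measure Ω} {d : ℕ}
    {R : (Fin d → ℤ) → Ω → ℕ∞} (hm : ∀ x, Measurable (R x)) (hi : iIndepFun R P)
    {x y : Fin d → ℤ} {r : ℕ} (hxy : Disjoint (box x (3 * r)) (box y (3 * r))) :
    P {ω | Crosses (fun z => R z ω) x r ∧ Crosses (fun z => R z ω) y r} =
      P {ω | Crosses (fun z => R z ω) x r} * P {ω | Crosses (fun z => R z ω) y r} := by
  classical
  -- Radii outside the box are set to `0`, harmlessly by locality. The box is finite, so its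
  -- configurations form a countable discrete space and measurability is free.
  let E (x : Fin d → ℤ) : Set (box x (3 * r) → ℕ∞) :=
    {ρ | Crosses (fun z => if h : z ∈ box x (3 * r) then ρ ⟨z, h⟩ else 0) x r}
  have hE : ∀ x, {ω | Crosses (fun z => R z ω) x r} =
      (fun ω (z : box x (3 * r)) => R z ω) ⁻¹' E x := by
    intro x
    ext ω
    exact crosses_congr fun z hz => by simp only [dif_pos hz]
  rw [Set.ofPred_and, hE x, hE y]
  exact (hi.indepFun_finset _ _ hxy hm).measure_inter_preimage_eq_mul _ _ .of_discrete
    .of_discrete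

/-- The largest probability of a crossing at scale `r`. -/
noncomputable def crossProb {Ω : Type*} [MeasurableSpace Ω] (P : Measure Ω) {d : ℕ}
    (R : (Fin d → ℤ) → Ω → ℕ∞) (r : ℕ) : ℝ≥0∞ :=
  ⨆ x, P {ω | Crosses (fun z => R z ω) x r}

/-- A union bound costs a factor of order `r^d`, which the moment of order `d` absorbs since `r ≤ j`
in the tail. -/
theorem measure_exists_long_le {Ω : Type*} [MeasurableSpace Ω] {P : Measure Ω} {d : ℕ}
    {R : (Fin d → ℤ) → Ω → ℕ∞} {ε : ℝ≥0∞} {s : ℕ → ℝ≥0∞}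
    (hR : ∀ x (k : ℕ), 0 < k → P {ω | (k : ℕ∞) ≤ R x ω} ≤ ε * tailSum s k)
    (x : Fin d → ℤ) (n : ℕ) {r : ℕ} (hr : 0 < r) :
    P {ω | ∃ y ∈ box x (n * r), (r : ℕ∞) ≤ R y ω} ≤
      ((2 * n + 1 : ℕ) : ℝ≥0∞) ^ d * ε * tailSum (fun j => (j : ℝ≥0∞) ^ d * s j) r := by
  calc P {ω | ∃ y ∈ box x (n * r), (r : ℕ∞) ≤ R y ω}
      = P (⋃ y ∈ box x (n * r), {ω | (r : ℕ∞) ≤ R y ω}) := by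
        congr 1
        ext ω
        simp
    _ ≤ ∑ y ∈ box x (n * r), P {ω | (r : ℕ∞) ≤ R y ω} := measure_biUnion_finset_le _ _
    _ ≤ ∑ _y ∈ box x (n * r), ε * tailSum s r := Finset.sum_le_sum fun y _ => hR y r hr
    _ = (box x (n * r)).card * (ε * tailSum s r) := by rw [Finset.sum_const, nsmul_eq_mul]
    _ ≤ ((2 * n + 1 : ℕ) : ℝ≥0∞) ^ d * (r : ℝ≥0∞) ^ d * (ε * tailSum s r) := by
        gcongr
        exact card_box_le x hr
    _ = ((2 * n + 1 : ℕ) : ℝ≥0∞) ^ d * ε * ((r : ℝ≥0∞) ^ d * tailSum s r) := by ring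
    _ ≤ _ := by
        gcongr
        exact pow_mul_tailSum_le s d r

theorem crossProb_one_le {Ω : Type*} [MeasurableSpace Ω] {P : Measure Ω} {d : ℕ}
    {R : (Fin d → ℤ) → Ω → ℕ∞} {ε : ℝ≥0∞} {s : ℕ → ℝ≥0∞}
    (hR : ∀ x (k : ℕ), 0 < k → P {ω | (k : ℕ∞) ≤ R x ω} ≤ ε * tailSum s k) :
    crossProb P R 1 ≤ 49 ^ d * ε * tailSum (fun j => (j : ℝ≥0∞) ^ d * s j) 1 := by
  refine iSup_le fun x => ?_
  calc P {ω | Crosses (fun z => R z ω) x 1}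
      ≤ P {ω | ∃ y ∈ box x (3 * 1), ((1 : ℕ) : ℕ∞) ≤ R y ω} :=
        measure_mono fun ω hω => exists_of_crosses_one hω
    _ ≤ _ := measure_exists_long_le hR x 3 one_pos
    -- `7^d` is weakened to `49^d` so that one smallness condition covers both the start and the
    -- recursion.
    _ ≤ _ := by
        gcongr
        norm_num

theorem crossProb_eight_mul_le {Ω : Type*} [MeasurableSpace Ω] {P : Measure Ω} {d : ℕ}
    {R : (Fin d → ℤ) → Ω → ℕ∞} {ε : ℝ≥0∞} {s : ℕ → ℝ≥0∞}
    (hm : ∀ x, Measurable (R x)) (hi : iIndepFun R P)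
    (hR : ∀ x (k : ℕ), 0 < k → P {ω | (k : ℕ∞) ≤ R x ω} ≤ ε * tailSum s k) {r : ℕ} (hr : 0 < r) :
    crossProb P R (8 * r) ≤ (49 ^ d) ^ 2 * crossProb P R r ^ 2 +
      49 ^ d * ε * tailSum (fun j => (j : ℝ≥0∞) ^ d * s j) r := by
  refine iSup_le fun x => ?_
  set B := box (0 : Fin d → ℤ) 24 with hB
  have hcard : (B.card : ℝ≥0∞) = 49 ^ d := by
    rw [hB, card_box]
    norm_num
  let E (j j' : Fin d → ℤ) : Set Ω :=
    {ω | Disjoint (box (gridPoint x r j) (3 * r)) (box (gridPoint x r j') (3 * r)) ∧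
      Crosses (fun z => R z ω) (gridPoint x r j) r ∧
      Crosses (fun z => R z ω) (gridPoint x r j') r}
  have hE : ∀ j j', P (E j j') ≤ crossProb P R r ^ 2 := by
    intro j j'
    by_cases hd : Disjoint (box (gridPoint x r j) (3 * r)) (box (gridPoint x r j') (3 * r))
    · have he : E j j' = {ω | Crosses (fun z => R z ω) (gridPoint x r j) r ∧
          Crosses (fun z => R z ω) (gridPoint x r j') r} := by
        ext ω
        exact and_iff_right hd
      rw [he, indep_crosses hm hi hd, sq]
      exact mul_le_mul' (le_iSup (fun x => P {ω | Crosses (fun z => R z ω) x r}) _)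
        (le_iSup (fun x => P {ω | Crosses (fun z => R z ω) x r}) _)
    · have he : E j j' = ∅ := Set.eq_empty_of_forall_notMem fun ω hω => hd hω.1
      simp [he]
  calc P {ω | Crosses (fun z => R z ω) x (8 * r)}
      ≤ P ((⋃ j ∈ B, ⋃ j' ∈ B, E j j') ∪ {ω | ∃ y ∈ box x (24 * r), (r : ℕ∞) ≤ R y ω}) := by
        refine measure_mono fun ω hω => ?_
        rcases exists_of_crosses_eight_mul hr hω with h | ⟨j, hj, j', hj', h⟩
        · exact Or.inr h
        · exact Or.inl (Set.mem_biUnion hj (Set.mem_biUnion hj' h))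
    _ ≤ P (⋃ j ∈ B, ⋃ j' ∈ B, E j j') + P {ω | ∃ y ∈ box x (24 * r), (r : ℕ∞) ≤ R y ω} :=
        measure_union_le _ _
    _ ≤ (49 ^ d) ^ 2 * crossProb P R r ^ 2 + _ := by
        refine add_le_add ?_ (measure_exists_long_le hR x 24 hr)
        calc P (⋃ j ∈ B, ⋃ j' ∈ B, E j j') ≤ ∑ j ∈ B, P (⋃ j' ∈ B, E j j') :=
              measure_biUnion_finset_le _ _
          _ ≤ ∑ j ∈ B, ∑ j' ∈ B, P (E j j') :=
              Finset.sum_le_sum fun j _ => measure_biUnion_finset_le _ _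
          _ ≤ ∑ _j ∈ B, ∑ _j' ∈ B, crossProb P R r ^ 2 :=
              Finset.sum_le_sum fun j _ => Finset.sum_le_sum fun j' _ => hE j j'
          _ = (49 ^ d) ^ 2 * crossProb P R r ^ 2 := by
              simp only [Finset.sum_const, nsmul_eq_mul, hcard]
              ring
    _ = _ := by norm_num

/-- Exchanging the sums over `w` and `j` leaves, for each `j`, at most the `7^d * j^d` sites of the
box of radius `3j`: the moment of order `d` again. -/
theorem measure_exists_distant_le {Ω : Type*} [MeasurableSpace Ω] {P : Measure Ω} {d : ℕ}
    {R : (Fin d → ℤ) → Ω → ℕ∞} {ε : ℝ≥0∞} {s : ℕ → ℝ≥0∞}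
    (hR : ∀ x (k : ℕ), 0 < k → P {ω | (k : ℕ∞) ≤ R x ω} ≤ ε * tailSum s k)
    (x : Fin d → ℤ) {r : ℕ} (hr : 0 < r) :
    P {ω | ∃ w, 3 * r < supDist x w ∧ (supDist x w : ℕ∞) ≤ 3 * R w ω} ≤
      7 ^ d * ε * tailSum (fun j => (j : ℝ≥0∞) ^ d * s j) r := by
  let E (w : Fin d → ℤ) : Set Ω := {ω | 3 * r < supDist x w ∧ (supDist x w : ℕ∞) ≤ 3 * R w ω}
  have hE : ∀ w, P (E w) ≤ ε * ∑' j, if r ≤ j ∧ w ∈ box x (3 * j) then s j else 0 := by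
    intro w
    by_cases hw : 3 * r < supDist x w
    -- `(supDist x w + 2) / 3` is the distance divided by `3` and rounded up.
    · have hsub : E w ⊆ {ω | (((supDist x w + 2) / 3 : ℕ) : ℕ∞) ≤ R w ω} := by
        rintro ω ⟨-, hω⟩
        simp only [Set.mem_ofPred_eq]
        induction hk : R w ω with
        | top => exact le_top
        | coe k =>
          rw [hk] at hω
          have : supDist x w ≤ 3 * k := by exact_mod_cast hω
          exact_mod_cast (by omega : (supDist x w + 2) / 3 ≤ k)
      refine (measure_mono hsub).trans ((hR w _ (by omega)).trans ?_)
      gcongr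
      refine ENNReal.tsum_le_tsum fun j => ?_
      by_cases hj : (supDist x w + 2) / 3 ≤ j
      · rw [if_pos hj, if_pos ⟨by omega, mem_box.2 (by omega)⟩]
      · rw [if_neg hj]
        exact zero_le
    · have he : E w = ∅ := Set.eq_empty_of_forall_notMem fun ω hω => hw hω.1
      simp [he]
  calc P {ω | ∃ w, 3 * r < supDist x w ∧ (supDist x w : ℕ∞) ≤ 3 * R w ω}
      = P (⋃ w, E w) := by
        congr 1
        ext ω
        simp [E]
    _ ≤ ∑' w, P (E w) := measure_iUnion_le _
    _ ≤ ∑' w, ε * ∑' j, if r ≤ j ∧ w ∈ box x (3 * j) then s j else 0 :=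
        ENNReal.tsum_le_tsum hE
    _ = ε * ∑' j, ∑' w, if r ≤ j ∧ w ∈ box x (3 * j) then s j else 0 := by
        rw [ENNReal.tsum_mul_left, ENNReal.tsum_comm]
    _ ≤ ε * ∑' j, 7 ^ d * if r ≤ j then (j : ℝ≥0∞) ^ d * s j else 0 := by
        gcongr with j
        by_cases hj : r ≤ j
        · simp only [hj, true_and, if_true]
          rw [tsum_eq_sum (s := box x (3 * j)) fun w hw => if_neg hw,
            Finset.sum_congr rfl fun w hw => if_pos hw, Finset.sum_const, nsmul_eq_mul,
            ← mul_assoc]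
          gcongr
          refine (card_box_le x (hr.trans_le hj)).trans_eq ?_
          norm_num
        · simp [hj]
    _ = _ := by
        rw [ENNReal.tsum_mul_left, tailSum]
        ring

theorem tendsto_crossProb {Ω : Type*} [MeasurableSpace Ω] {P : Measure Ω} {d : ℕ}
    {R : (Fin d → ℤ) → Ω → ℕ∞} {ε : ℝ≥0∞} {s : ℕ → ℝ≥0∞}
    (hm : ∀ x, Measurable (R x)) (hi : iIndepFun R P)
    (hR : ∀ x (k : ℕ), 0 < k → P {ω | (k : ℕ∞) ≤ R x ω} ≤ ε * tailSum s k)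
    (hs : ∑' j : ℕ, (j : ℝ≥0∞) ^ d * s j ≠ ∞) (hε' : ε ≠ ∞)
    (hε : 49 ^ d * ε * ∑' j : ℕ, (j : ℝ≥0∞) ^ d * s j ≤ (4 * (49 ^ d) ^ 2)⁻¹) :
    Tendsto (fun n => crossProb P R (8 ^ n)) atTop (𝓝 0) := by
  have hC : (49 ^ d : ℝ≥0∞) ≠ ∞ := ENNReal.pow_ne_top (by simp)
  have hC₀ : (49 ^ d : ℝ≥0∞) ≠ 0 := pow_ne_zero _ (by simp)
  have hb : ∀ n, 49 ^ d * ε * tailSum (fun j => (j : ℝ≥0∞) ^ d * s j) n ≤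
      (4 * (49 ^ d) ^ 2)⁻¹ := fun n =>
    le_trans (mul_le_mul_right (tailSum_le_tsum _ n) _) hε
  refine tendsto_zero_of_le_sq (A := (49 ^ d) ^ 2) (b := (4 * (49 ^ d) ^ 2)⁻¹)
    (g := fun n => 49 ^ d * ε * tailSum (fun j => (j : ℝ≥0∞) ^ d * s j) (8 ^ n))
    ?_ ?_ ?_ (fun n => hb _) ?_ ?_
  · rw [ENNReal.mul_inv (by simp) (by simp)]
    calc ((49 ^ d) ^ 2 : ℝ≥0∞) * (2 * (4⁻¹ * ((49 ^ d) ^ 2)⁻¹))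
        = (((49 ^ d) ^ 2 : ℝ≥0∞) * ((49 ^ d) ^ 2)⁻¹) * (2 * 4⁻¹) := by ring
      _ = 2 * 4⁻¹ := by
          rw [ENNReal.mul_inv_cancel (pow_ne_zero _ hC₀) (ENNReal.pow_ne_top hC), one_mul]
      _ = 2⁻¹ := by
          rw [show (4 : ℝ≥0∞) = 2 * 2 by norm_num, ENNReal.mul_inv (by simp) (by simp),
            ← mul_assoc, ENNReal.mul_inv_cancel (by simp) (by simp), one_mul]
      _ ≤ _ := le_rfl
  · exact ENNReal.inv_ne_top.2 (mul_ne_zero (by simp) (pow_ne_zero _ hC₀))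
  · refine (crossProb_one_le hR).trans ((hb 1).trans ?_)
    rw [two_mul]
    exact le_self_add
  · have h := (tendsto_tailSum hs).comp (tendsto_pow_atTop_atTop_of_one_lt (by simp : 1 < 8))
    have h' := ENNReal.Tendsto.const_mul (a := 49 ^ d * ε) h
      (Or.inr (ENNReal.mul_ne_top hC hε'))
    rwa [mul_zero] at h'
  · intro n
    rw [pow_succ']
    exact crossProb_eight_mul_le hm hi hR (by positivity)

/-- If independent radii have small tails with a finite moment of order `d`, then the graphs whose
edges they cover have only finite components. -/
theorem ae_finite_components {Ω : Type*} [MeasurableSpace Ω] {P : Measure Ω} {d : ℕ}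
    {R : (Fin d → ℤ) → Ω → ℕ∞} {ε : ℝ≥0∞} {s : ℕ → ℝ≥0∞}
    (hm : ∀ x, Measurable (R x)) (hi : iIndepFun R P)
    (hR : ∀ x (k : ℕ), 0 < k → P {ω | (k : ℕ∞) ≤ R x ω} ≤ ε * tailSum s k)
    (hs : ∑' j : ℕ, (j : ℝ≥0∞) ^ d * s j ≠ ∞) (hε' : ε ≠ ∞)
    (hε : 49 ^ d * ε * ∑' j : ℕ, (j : ℝ≥0∞) ^ d * s j ≤ (4 * (49 ^ d) ^ 2)⁻¹) :
    ∀ᵐ ω ∂P, ∀ G : SimpleGraph (Fin d → ℤ), (∀ u v, G.Adj u v → Linked (fun z => R z ω) u v) →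
      ∀ C : G.ConnectedComponent, C.supp.Finite := by
  have key : ∀ x, ∀ᵐ ω ∂P, ¬ ∀ r,
      Crosses (fun z => R z ω) x r ∨ (∃ u ∈ box x (2 * r), (r : ℕ∞) ≤ R u ω) ∨
        ∃ w, 3 * r < supDist x w ∧ (supDist x w : ℕ∞) ≤ 3 * R w ω := by
    intro x
    rw [ae_iff]
    simp only [not_not]
    set τ := tailSum (fun j => (j : ℝ≥0∞) ^ d * s j)
    have hbound : ∀ n : ℕ, P {ω | ∀ r,
        Crosses (fun z => R z ω) x r ∨ (∃ u ∈ box x (2 * r), (r : ℕ∞) ≤ R u ω) ∨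
          ∃ w, 3 * r < supDist x w ∧ (supDist x w : ℕ∞) ≤ 3 * R w ω} ≤
        crossProb P R (8 ^ n) + (5 ^ d * ε * τ (8 ^ n) + 7 ^ d * ε * τ (8 ^ n)) := by
      intro n
      have hpos : 0 < 8 ^ n := by positivity
      refine (measure_mono (Set.ofPred_subset_ofPred.2 fun ω hω => hω (8 ^ n))).trans
        ((measure_union_le {ω | Crosses (fun z => R z ω) x (8 ^ n)} _).trans (add_le_add
          (le_iSup (fun x => P {ω | Crosses (fun z => R z ω) x (8 ^ n)}) x)
          ((measure_union_le {ω | ∃ u ∈ box x (2 * 8 ^ n), ((8 ^ n : ℕ) : ℕ∞) ≤ R u ω} _).trans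
            (add_le_add ?_ (measure_exists_distant_le hR x hpos)))))
      refine (measure_exists_long_le hR x 2 hpos).trans_eq ?_
      norm_num [τ]
    have hτ : ∀ c : ℝ≥0∞, c ≠ ∞ → Tendsto (fun n : ℕ => c ^ d * ε * τ (8 ^ n)) atTop (𝓝 0) := by
      intro c hc
      have h := (tendsto_tailSum hs).comp (tendsto_pow_atTop_atTop_of_one_lt (by simp : 1 < 8))
      have h' := ENNReal.Tendsto.const_mul (a := c ^ d * ε) h
        (Or.inr (ENNReal.mul_ne_top (ENNReal.pow_ne_top hc) hε'))
      rwa [mul_zero] at h'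
    have hlim := (tendsto_crossProb hm hi hR hs hε' hε).add
      ((hτ 5 (by simp)).add (hτ 7 (by simp)))
    simp only [add_zero] at hlim
    exact le_antisymm (ge_of_tendsto' hlim hbound) zero_le
  filter_upwards [ae_all_iff.2 key] with ω hω G hG C
  by_contra hC
  obtain ⟨x, hx⟩ := Set.Infinite.nonempty hC
  exact hω x fun r => exists_of_infinite_component hG hC hx r

/-! ### Poisson clocks and the tail of the reach. -/

theorem expMeasure_Iic_le {r : ℝ} (hr : 0 < r) (t : ℝ) :
    expMeasure r (Set.Iic t) ≤ ENNReal.ofReal (r * t) := by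
  have := isProbabilityMeasure_expMeasure hr
  rw [← ofReal_cdf, cdf_expMeasure_eq hr]
  split_ifs with h
  · refine ENNReal.ofReal_le_ofReal ?_
    have := Real.add_one_le_exp (-(r * t))
    linarith
  · simp

theorem sum_interarrival {Ω : Type*} (T : ℕ → Ω → ℝ) (n : ℕ) (ω : Ω) :
    ∑ i ∈ Finset.range (n + 1), interarrival T i ω = T n ω := by
  induction n with
  | zero => simp [interarrival]
  | succ n ih =>
    rw [Finset.sum_range_succ, ih]
    simp [interarrival]

theorem IsPoissonProcess.measurable_interarrival {Ω : Type*} [MeasurableSpace Ω] {P : Measure Ω}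
    {r : ℝ} {T : ℕ → Ω → ℝ} (h : IsPoissonProcess P r T) (n : ℕ) :
    Measurable (interarrival T n) := by
  cases n with
  | zero => exact h.measurable 0
  | succ n => exact (h.measurable (n + 1)).sub (h.measurable n)

/-- The `n`-th epoch comes before `t` only if all the waiting times up to it are at most `t`. -/
theorem IsPoissonProcess.measure_le_pow {Ω : Type*} [MeasurableSpace Ω] {P : Measure Ω}
    {r : ℝ} (hr : 0 < r) {T : ℕ → Ω → ℝ} (h : IsPoissonProcess P r T) (n : ℕ) (t : ℝ) :
    P {ω | T n ω ≤ t} ≤ ENNReal.ofReal (r * t) ^ (n + 1) := by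
  have hlaw : ∀ i t, P (interarrival T i ⁻¹' Set.Iic t) ≤ ENNReal.ofReal (r * t) := fun i t => by
    rw [← Measure.map_apply (h.measurable_interarrival i) measurableSet_Iic, h.law]
    exact expMeasure_Iic_le hr t
  have hnonneg : ∀ᵐ ω ∂P, ∀ i, 0 ≤ interarrival T i ω := by
    refine ae_all_iff.2 fun i => ?_
    rw [ae_iff]
    -- The bound `r * t` at `t = 0` shows that negative waiting times have probability `0`.
    refine le_antisymm ((measure_mono fun ω hω => ?_).trans ((hlaw i 0).trans_eq (by simp)))
      zero_le
    exact (not_le.1 hω).le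
  calc P {ω | T n ω ≤ t}
      ≤ P (⋂ i ∈ Finset.range (n + 1), interarrival T i ⁻¹' Set.Iic t) := by
        refine measure_mono_ae ?_
        filter_upwards [hnonneg] with ω hω hT
        refine Set.mem_iInter₂.2 fun i hi => ?_
        refine le_trans ?_ (show T n ω ≤ t from hT)
        rw [← sum_interarrival T n ω]
        exact Finset.single_le_sum (f := fun i => interarrival T i ω) (fun j _ => hω j) hi
    _ = ∏ i ∈ Finset.range (n + 1), P (interarrival T i ⁻¹' Set.Iic t) :=
        h.indep.measure_inter_preimage_eq_mul _ fun i _ => measurableSet_Iic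
    _ ≤ ∏ _i ∈ Finset.range (n + 1), ENNReal.ofReal (r * t) :=
        Finset.prod_le_prod' fun i _ => hlaw i t
    _ = _ := by simp

/-- The largest mark of an epoch in `(0, t]`. -/
noncomputable def reach (t : ℝ) (p : (ℕ → ℝ) × (ℕ → ℕ)) : ℕ∞ :=
  open Classical in ⨆ n, if p.1 n ∈ Set.Ioc 0 t then (p.2 n : ℕ∞) else 0

/-- Positivity of `k` matters: `0` is the value contributed by epochs outside `(0, t]`. -/
theorem le_reach_iff {t : ℝ} {p : (ℕ → ℝ) × (ℕ → ℕ)} {k : ℕ} (hk : 0 < k) :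
    (k : ℕ∞) ≤ reach t p ↔ ∃ n, p.1 n ∈ Set.Ioc 0 t ∧ k ≤ p.2 n := by
  constructor
  · intro h
    have h' : ((k - 1 : ℕ) : ℕ∞) < reach t p := lt_of_lt_of_le (Nat.cast_lt.2 (by omega)) h
    obtain ⟨n, hn⟩ := lt_iSup_iff.1 h'
    split_ifs at hn with hT
    · have := Nat.cast_lt.1 hn
      exact ⟨n, hT, by omega⟩
    · exact absurd hn not_lt_zero
  · rintro ⟨n, hT, hn⟩
    refine le_trans ?_ (le_iSup _ n)
    rw [if_pos hT]
    exact Nat.cast_le.2 hn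

theorem measurable_reach (t : ℝ) : Measurable (reach t) := by
  have h : ∀ k : ℕ, MeasurableSet {p | (k : ℕ∞) ≤ reach t p} := by
    intro k
    rcases Nat.eq_zero_or_pos k with rfl | hk
    · simp
    · simp only [le_reach_iff hk, Set.ofPred_exists, Set.ofPred_and]
      refine MeasurableSet.iUnion fun n => MeasurableSet.inter ?_ ?_
      · exact ((measurable_pi_apply n).comp measurable_fst) measurableSet_Ioc
      · exact ((measurable_pi_apply n).comp measurable_snd)
          (MeasurableSet.of_discrete (s := {m : ℕ | k ≤ m}))
  refine measurable_to_countable' fun y => ?_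
  induction y with
  | top =>
    have : reach t ⁻¹' {⊤} = ⋂ k : ℕ, {p | (k : ℕ∞) ≤ reach t p} := by
      ext p
      simp only [Set.mem_preimage, Set.mem_singleton_iff, Set.mem_iInter, Set.mem_ofPred_eq]
      exact ENat.eq_top_iff_forall_ge
    rw [this]
    exact MeasurableSet.iInter h
  | coe m =>
    have : reach t ⁻¹' {(m : ℕ∞)} =
        {p | (m : ℕ∞) ≤ reach t p} \ {p | ((m + 1 : ℕ) : ℕ∞) ≤ reach t p} := by
      ext p
      simp only [Set.mem_preimage, Set.mem_singleton_iff, Set.mem_sdiff, Set.mem_ofPred_eq, not_le]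
      induction reach t p with
      | top => simp
      | coe n =>
        norm_cast
        omega
    rw [this]
    exact (h m).diff (h (m + 1))

theorem linked_of_harrisGraph_adj {d : ℕ} {T : (Fin d → ℤ) → ℕ → ℝ} {K : (Fin d → ℤ) → ℕ → ℕ}
    {t : ℝ} {u v : Fin d → ℤ} (h : (harrisGraph T K 0 t).Adj u v) :
    Linked (fun x => reach t (T x, K x)) u v := by
  have hpos := supDist_pos h.1
  rcases h.2 with ⟨n, hT, hn⟩ | ⟨n, hT, hn⟩
  · exact Or.inl ((le_reach_iff hpos).2 ⟨n, hT, supDist_le_of_mem_l1Ball hn⟩)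
  · refine Or.inr ((le_reach_iff hpos).2 ⟨n, hT, ?_⟩)
    rw [supDist_comm]
    exact supDist_le_of_mem_l1Ball hn

theorem IsMarkedPoissonProcess.measure_le_reach_le {Ω : Type*} [MeasurableSpace Ω]
    {P : Measure Ω} {r : ℝ} (hr : 0 < r) {ν : PMF ℕ} {T : ℕ → Ω → ℝ} {K : ℕ → Ω → ℕ}
    (h : IsMarkedPoissonProcess P r ν T K) {t : ℝ} (ht : ENNReal.ofReal (r * t) ≤ 2⁻¹)
    {k : ℕ} (hk : 0 < k) :
    P {ω | (k : ℕ∞) ≤ reach t (fun n => T n ω, fun n => K n ω)} ≤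
      2 * ENNReal.ofReal (r * t) * tailSum ν k := by
  set e := ENNReal.ofReal (r * t)
  have hK : ∀ n, P (K n ⁻¹' Set.Ici k) = tailSum ν k := fun n => by
    rw [← Measure.map_apply (h.measurable_mark n) measurableSet_Ici, h.law_mark,
      PMF.toMeasure_apply _ measurableSet_Ici, tailSum]
    refine tsum_congr fun j => ?_
    simp [Set.indicator_apply]
  have hTK : ∀ n, P {ω | T n ω ≤ t ∧ k ≤ K n ω} ≤ e ^ (n + 1) * tailSum ν k := by
    intro n
    have hind : IndepFun (T n) (K n) P :=
      h.indep.comp (φ := fun f : ℕ → ℝ => f n) (ψ := fun f : ℕ → ℕ => f n)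
        (measurable_pi_apply n) (measurable_pi_apply n)
    calc P {ω | T n ω ≤ t ∧ k ≤ K n ω}
        = P (T n ⁻¹' Set.Iic t ∩ K n ⁻¹' Set.Ici k) := rfl
      _ = P (T n ⁻¹' Set.Iic t) * P (K n ⁻¹' Set.Ici k) :=
          hind.measure_inter_preimage_eq_mul _ _ measurableSet_Iic measurableSet_Ici
      _ ≤ e ^ (n + 1) * tailSum ν k := by
          rw [hK]
          gcongr
          exact h.poisson.measure_le_pow hr n t
  calc P {ω | (k : ℕ∞) ≤ reach t (fun n => T n ω, fun n => K n ω)}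
      ≤ P (⋃ n, {ω | T n ω ≤ t ∧ k ≤ K n ω}) := by
        refine measure_mono fun ω hω => ?_
        obtain ⟨n, hT, hn⟩ := (le_reach_iff hk).1 hω
        exact Set.mem_iUnion.2 ⟨n, hT.2, hn⟩
    _ ≤ ∑' n, P {ω | T n ω ≤ t ∧ k ≤ K n ω} := measure_iUnion_le _
    _ ≤ ∑' n, e ^ (n + 1) * tailSum ν k := ENNReal.tsum_le_tsum hTK
    -- Geometric series over the index of the epoch; `e ≤ 1/2` bounds `(1 - e)⁻¹` by `2`.
    _ = (1 - e)⁻¹ * e * tailSum ν k := by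
        rw [ENNReal.tsum_mul_right]
        simp only [pow_succ]
        rw [ENNReal.tsum_mul_right, ENNReal.tsum_geometric]
    _ ≤ 2 * e * tailSum ν k := by
        gcongr
        rw [ENNReal.inv_le_iff_inv_le, ← ENNReal.one_sub_inv_two]
        exact tsub_le_tsub_left ht 1

/-! ### Choice of `t₀` and conclusion. -/

theorem theorem5 (d : ℕ) (M : (Fin d → ℤ) → ℝ) (ν : (Fin d → ℤ) → PMF ℕ)
    (hM_inf : 0 < ⨅ x, M x) (hM_sup : BddAbove (Set.range M))
    (hν : ∑' r : ℕ, (r : ℝ≥0∞) ^ d * (⨆ x, ν x r) < ∞) :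
    ∃ t₀ : ℝ, 0 < t₀ ∧
      ∀ (Ω : Type*) [MeasurableSpace Ω] (P : Measure Ω) [IsProbabilityMeasure P]
        (T : (Fin d → ℤ) → ℕ → Ω → ℝ) (K : (Fin d → ℤ) → ℕ → Ω → ℕ),
        IsMarkedPoissonFamily P M ν T K →
        ∀ t : ℝ, 0 ≤ t → t ≤ t₀ →
          ∀ᵐ ω ∂P, ∀ C : (harrisGraph (fun x n => T x n ω) (fun x n => K x n ω) 0
            t).ConnectedComponent, C.supp.Finite := by
  -- A real infimum of a set unbounded below is `0` by convention, so a positive one forces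
  -- boundedness.
  have hbdd : BddBelow (Set.range M) := by
    by_contra h
    exact hM_inf.ne' (Real.iInf_of_not_bddBelow h)
  have hM : ∀ x, 0 < M x := fun x => hM_inf.trans_le (ciInf_le hbdd x)
  obtain ⟨B, hB⟩ := hM_sup
  have hMB : ∀ x, M x ≤ B := fun x => hB (Set.mem_range_self x)
  have hBpos : 0 < B := (hM 0).trans_le (hMB 0)
  set s : ℕ → ℝ≥0∞ := fun r => ⨆ x, ν x r with hs
  set S := ∑' r : ℕ, (r : ℝ≥0∞) ^ d * s r with hS
  -- `c` will bound every `M x * t`: the first condition starts the recursion with `ε = 2 * c`, the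
  -- second controls the geometric series.
  obtain ⟨c, hc, hcS⟩ : ∃ c : ℝ, 0 < c ∧
      49 ^ d * ENNReal.ofReal (2 * c) * S ≤ (4 * (49 ^ d) ^ 2)⁻¹ ∧
      ENNReal.ofReal c ≤ 2⁻¹ := by
    obtain ⟨n, hn, hnS⟩ := ENNReal.exists_nnreal_pos_mul_lt (a := 49 ^ d * S)
      (b := (4 * (49 ^ d) ^ 2)⁻¹)
      (ENNReal.mul_ne_top (ENNReal.pow_ne_top (by simp)) hν.ne)
      (ENNReal.inv_ne_zero.2 (ENNReal.mul_ne_top (by simp)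
        (ENNReal.pow_ne_top (ENNReal.pow_ne_top (by simp)))))
    have hn' : (0 : ℝ) < n := hn
    refine ⟨min (n / 2) 2⁻¹, by positivity, ?_, ?_⟩
    · have hle : ENNReal.ofReal (2 * min ((n : ℝ) / 2) 2⁻¹) ≤ n := by
        rw [← ENNReal.ofReal_coe_nnreal]
        refine ENNReal.ofReal_le_ofReal ?_
        linarith [min_le_left ((n : ℝ) / 2) 2⁻¹]
      calc 49 ^ d * ENNReal.ofReal (2 * min ((n : ℝ) / 2) 2⁻¹) * S
          = ENNReal.ofReal (2 * min ((n : ℝ) / 2) 2⁻¹) * (49 ^ d * S) := by ring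
        _ ≤ n * (49 ^ d * S) := by gcongr
        _ ≤ _ := hnS.le
    · refine (ENNReal.ofReal_le_ofReal (min_le_right _ _)).trans_eq ?_
      rw [ENNReal.ofReal_inv_of_pos two_pos, ENNReal.ofReal_ofNat]
  refine ⟨c / B, by positivity, fun Ω _ P _ T K h t ht₀ ht => ?_⟩
  have hMt : ∀ x, M x * t ≤ c := fun x =>
    calc M x * t ≤ B * t := by gcongr; exact hMB x
      _ ≤ B * (c / B) := by gcongr
      _ = c := by field_simp
  have hi : iIndepFun (fun x ω => reach t (fun n => T x n ω, fun n => K x n ω)) P :=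
    h.indep.comp (fun _ => reach t) fun _ => measurable_reach t
  have hm : ∀ x, Measurable fun ω => reach t (fun n => T x n ω, fun n => K x n ω) := fun x =>
    (measurable_reach t).comp ((measurable_pi_lambda _ (h.marked x).poisson.measurable).prodMk
      (measurable_pi_lambda _ (h.marked x).measurable_mark))
  have hR : ∀ x (k : ℕ), 0 < k →
      P {ω | (k : ℕ∞) ≤ reach t (fun n => T x n ω, fun n => K x n ω)} ≤
        ENNReal.ofReal (2 * c) * tailSum s k := by
    intro x k hk
    have hle := ENNReal.ofReal_le_ofReal (hMt x)
    refine ((h.marked x).measure_le_reach_le (hM x) (hle.trans hcS.2) hk).trans ?_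
    refine mul_le_mul' ?_ (ENNReal.tsum_le_tsum fun j => ?_)
    · rw [ENNReal.ofReal_mul zero_le_two, ENNReal.ofReal_ofNat]
      gcongr
    · split_ifs
      · exact le_iSup (fun x => ν x j) x
      · exact le_rfl
  filter_upwards [ae_finite_components hm hi hR hν.ne ENNReal.ofReal_ne_top hcS.1] with ω hω
  exact hω _ fun u v huv => linked_of_harrisGraph_adj huv
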